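/- Let $(\mathcal V,\otimes,I)$ be a complete and cocomplete closed symmetric monoidal category, and let $\mathcal V\text{-}\mathbf{Cat}$ be the 2-category of $\mathcal V$-categories, $\mathcal V$-functors and $\mathcal V$-natural transformations. A $1$-cell $e\colon X\to Y$ of a bicategory $\mathcal K$ is *orthogonal* to a $1$-cell $m\colon Z\to W$ if the square of hom-categories with corners $\mathcal K(Y,Z)$, $\mathcal K(Y,W)$, $\mathcal K(X,Z)$, $\mathcal K(X,W)$, whose functors are given by composition with $e$ and with $m$ and which commutes up to the associativity isomorphism, is a bipullback in $\mathbf{Cat}$. An *orthogonal factorization system* on $\mathcal K$ is a pair $(\mathcal E,\mathcal M)$ of classes of $1$-cells such that (i) every $1$-cell is isomorphic to a $1$-cell in $\mathcal E$ followed by a $1$-cell in $\mathcal M$, and (ii) every $e\in\mathcal E$ is orthogonal to every $m\in\mathcal M$. It is *generated* by a collection $\mathcal G$ of $1$-cells if $\mathcal M$ consists of precisely those $1$-cells to which every member of $\mathcal G$ is orthogonal. For $\mathcal V$-categories $\mathcal A,\mathcal B$ and a $\mathcal V$-profunctor $P\colon\mathcal B^{\mathrm{op}}\otimes\mathcal A\to\mathcal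 V$, the *collage* of $P$ is the $\mathcal V$-category $\mathcal C_P$ with objects $\mathrm{ob}\,\mathcal A\sqcup\mathrm{ob}\,\mathcal B$ and hom-objects $\mathcal C_P(b',b)=\mathcal B(b',b)$, $\mathcal C_P(b,a)=P(b,a)$, $\mathcal C_P(a,a')=\mathcal A(a,a')$, $\mathcal C_P(a,b)=\emptyset$ (the initial object), with composition given by that of $\mathcal A$ and $\mathcal B$ and by the actions of $\mathcal A$ and $\mathcal B$ on $P$; the inclusions of $\mathcal A$ and $\mathcal B$ induce a $\mathcal V$-functor $\mathcal A\sqcup\mathcal B\to\mathcal C_P$. **Lemma.** The essentially surjective $\mathcal V$-functors (left class) and the $\mathcal V$-fully faithful functors (right class) form an orthogonal factorization system on $\mathcal V\text{-}\mathbf{Cat}$, and this orthogonal factorization system is generated by the collages $\mathcal A\sqcup\mathcal B\to\mathcal C_P$ of $\mathcal V$-profunctors $P\colon\mathcal B^{\mathrm{op}}\otimes\mathcal A\to\mathcal V$. In particular, every $\mathcal V$-functor to which all collages $\mathcal A\sqcup\mathcal B\to\mathcal C_P$ are orthogonal is $\mathcal V$-fully faithful. -/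

import Mathlib

open CategoryTheory MonoidalCategory Limits

namespace EnrichedOFS

/-! ### Orthogonal factorization systems in a bicategory -/

section Bicat

open Bicategory

universe w₂ w₁ w₀

variable {B : Type w₀} [Bicategory.{w₂, w₁} B]

/-- The canonical functor from `K(Y, Z)` to the pseudo-pullback (iso-comma category) of
`K(X, m) : K(X, Z) ⥤ K(X, W)` and `K(e, W) : K(Y, W) ⥤ K(X, W)`, induced by the square of
hom-categories which commutes up to the associator `(e ≫ h) ≫ m ≅ e ≫ (h ≫ m)`. -/
def orthComparison {X Y Z W : B} (e : X ⟶ Y) (m : Z ⟶ W) :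
    (Y ⟶ Z) ⥤ CategoricalPullback (postcomp X m) (precomp W e) where
  obj h :=
    { fst := e ≫ h
      snd := h ≫ m
      iso := α_ e h m }
  map θ :=
    { fst := e ◁ θ
      snd := θ ▷ m
      w := by
        dsimp only [postcomp, precomp]
        rw [Bicategory.whisker_assoc]
        simp }
  map_id h := by apply CategoricalPullback.hom_ext <;> simp
  map_comp θ θ' := by apply CategoricalPullback.hom_ext <;> simp

/-- `e` is (left) orthogonal to `m`: the square with corners `K(Y, Z)`, `K(Y, W)`, `K(X, Z)`,
`K(X, W)` is a bipullback of categories. -/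
def IsOrthogonal {X Y Z W : B} (e : X ⟶ Y) (m : Z ⟶ W) : Prop :=
  (orthComparison e m).IsEquivalence

/-- Orthogonal factorization systems in a bicategory. -/
structure IsOrthogonalFactorizationSystem (E M : MorphismProperty B) : Prop where
  /-- every 1-cell is isomorphic to a 1-cell in `E` followed by a 1-cell in `M` -/
  factorization : ∀ {X Y : B} (f : X ⟶ Y),
    ∃ (Z : B) (e : X ⟶ Z) (m : Z ⟶ Y), E e ∧ M m ∧ Nonempty (f ≅ e ≫ m)
  /-- 1-cells in `E` are orthogonal to 1-cells in `M` -/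
  orthogonal : ∀ {X Y Z W : B} (e : X ⟶ Y) (m : Z ⟶ W), E e → M m → IsOrthogonal e m

/-- The class of 1-cells `m` to which every 1-cell in the collection `G` is orthogonal. -/
def rightOrthogonal (G : MorphismProperty B) : MorphismProperty B :=
  fun _ _ m => ∀ ⦃X Y : B⦄ (e : X ⟶ Y), G e → IsOrthogonal e m

/-- An orthogonal factorization system `(E, M)` is generated by a collection `G` of 1-cells if
its right class consists of precisely those 1-cells to which all members of `G` are orthogonal. -/
structure IsGeneratedOrthogonalFactorizationSystem (E M G : MorphismProperty B) : Prop
    extends IsOrthogonalFactorizationSystem E M where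
  right_iff : ∀ {Z W : B} (m : Z ⟶ W), M m ↔ rightOrthogonal G m

end Bicat

/-! ### The 2-category of `V`-categories

The 2-cells are the `V`-natural transformations, whose naturality is an equation between
morphisms out of the hom-objects of the domain (naturality with respect to the underlying
ordinary category is weaker in general). -/

section VCat

universe w v u w₁ w₂ w₃ w₄

variable {V : Type u} [Category.{v} V] [MonoidalCategory V]

section Aux

variable {C : Type w₁} [EnrichedCategory V C]

/-- `C(x, y) ⟶ C(x, z)`, composition with `f : I ⟶ C(y, z)`. -/
def ePost (x : C) {y z : C} (f : 𝟙_ V ⟶ (y ⟶[V] z)) : (x ⟶[V] y) ⟶ (x ⟶[V] z) :=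
  (ρ_ _).inv ≫ _ ◁ f ≫ eComp V x y z

/-- `C(y, z) ⟶ C(x, z)`, composition with `f : I ⟶ C(x, y)`. -/
def ePre {x y : C} (f : 𝟙_ V ⟶ (x ⟶[V] y)) (z : C) : (y ⟶[V] z) ⟶ (x ⟶[V] z) :=
  (λ_ _).inv ≫ f ▷ _ ≫ eComp V x y z

/-- Composition `I ⟶ I ⊗ I ⟶ C(x, y) ⊗ C(y, z) ⟶ C(x, z)` in the underlying category. -/
def eUnitComp {x y z : C} (f : 𝟙_ V ⟶ (x ⟶[V] y)) (g : 𝟙_ V ⟶ (y ⟶[V] z)) :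
    𝟙_ V ⟶ (x ⟶[V] z) :=
  (λ_ (𝟙_ V)).inv ≫ (f ⊗ₘ g) ≫ eComp V x y z

lemma eUnitComp_eq_ePost {x y z : C} (f : 𝟙_ V ⟶ (x ⟶[V] y)) (g : 𝟙_ V ⟶ (y ⟶[V] z)) :
    eUnitComp f g = f ≫ ePost x g := by
  rw [eUnitComp, ePost, MonoidalCategory.tensorHom_def, unitors_inv_equal,
    rightUnitor_inv_naturality_assoc, Category.assoc]

lemma eUnitComp_eq_ePre {x y z : C} (f : 𝟙_ V ⟶ (x ⟶[V] y)) (g : 𝟙_ V ⟶ (y ⟶[V] z)) :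
    eUnitComp f g = g ≫ ePre f z := by
  rw [eUnitComp, ePre, MonoidalCategory.tensorHom_def', leftUnitor_inv_naturality_assoc,
    Category.assoc]

@[simp] lemma ePost_id (x y : C) : ePost x (eId V y) = 𝟙 _ := by simp [ePost]

@[simp] lemma ePre_id (x y : C) : ePre (eId V x) y = 𝟙 _ := by simp [ePre]

lemma eComp_ePost (x y : C) {z t : C} (g : 𝟙_ V ⟶ (z ⟶[V] t)) :
    eComp V x y z ≫ ePost x g = _ ◁ ePost y g ≫ eComp V x y t := by
  have h := e_assoc V x y z t
  simp only [ePost, rightUnitor_inv_naturality_assoc, ← whisker_exchange_assoc,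
    MonoidalCategory.whiskerLeft_comp, Category.assoc] at h ⊢
  rw [← h]
  simp

lemma ePost_eUnitComp (x : C) {y z t : C} (f : 𝟙_ V ⟶ (y ⟶[V] z)) (g : 𝟙_ V ⟶ (z ⟶[V] t)) :
    ePost x (eUnitComp f g) = ePost x f ≫ ePost x g := by
  rw [ePost, ePost, Category.assoc, Category.assoc, eComp_ePost, eUnitComp_eq_ePost]
  simp

lemma ePre_eComp {x y : C} (f : 𝟙_ V ⟶ (x ⟶[V] y)) (z t : C) :
    eComp V y z t ≫ ePre f t = ePre f z ▷ _ ≫ eComp V x z t := by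
  have h := e_assoc' V x y z t
  simp only [ePre, leftUnitor_inv_naturality_assoc, whisker_exchange_assoc,
    comp_whiskerRight, Category.assoc]
  rw [← h]
  simp

lemma ePre_eUnitComp {x y z : C} (f : 𝟙_ V ⟶ (x ⟶[V] y)) (g : 𝟙_ V ⟶ (y ⟶[V] z)) (t : C) :
    ePre (eUnitComp f g) t = ePre g t ≫ ePre f t := by
  rw [ePre, ePre, Category.assoc, Category.assoc, ePre_eComp, eUnitComp_eq_ePre]
  simp

lemma ePost_comp_ePre {x y z t : C} (f : 𝟙_ V ⟶ (x ⟶[V] y)) (g : 𝟙_ V ⟶ (z ⟶[V] t)) :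
    ePost y g ≫ ePre f t = ePre f z ≫ ePost x g := by
  rw [ePost, Category.assoc, Category.assoc, ePre_eComp, ePost, rightUnitor_inv_naturality_assoc,
    whisker_exchange_assoc]

lemma eUnitComp_assoc {x y z t : C} (f : 𝟙_ V ⟶ (x ⟶[V] y)) (g : 𝟙_ V ⟶ (y ⟶[V] z))
    (h : 𝟙_ V ⟶ (z ⟶[V] t)) : eUnitComp (eUnitComp f g) h = eUnitComp f (eUnitComp g h) := by
  simp [eUnitComp_eq_ePost, ← ePost_eUnitComp]

@[simp] lemma eUnitComp_id {x y : C} (f : 𝟙_ V ⟶ (x ⟶[V] y)) : eUnitComp f (eId V y) = f := by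
  simp [eUnitComp_eq_ePost]

@[simp] lemma id_eUnitComp {x y : C} (f : 𝟙_ V ⟶ (x ⟶[V] y)) : eUnitComp (eId V x) f = f := by
  simp [eUnitComp_eq_ePre]

variable {D : Type w₂} [EnrichedCategory V D] (F : EnrichedFunctor V C D)

lemma ePost_map (x : C) {y z : C} (f : 𝟙_ V ⟶ (y ⟶[V] z)) :
    ePost x f ≫ F.map x z = F.map x y ≫ ePost (F.obj x) (f ≫ F.map y z) := by
  simp only [ePost, Category.assoc, EnrichedFunctor.map_comp, rightUnitor_inv_naturality_assoc,
    MonoidalCategory.tensorHom_def]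
  simp [whisker_exchange_assoc]

lemma ePre_map {x y : C} (f : 𝟙_ V ⟶ (x ⟶[V] y)) (z : C) :
    ePre f z ≫ F.map x z = F.map y z ≫ ePre (f ≫ F.map x y) (F.obj z) := by
  rw [ePre, ePre, Category.assoc, Category.assoc, EnrichedFunctor.map_comp,
    leftUnitor_inv_naturality_assoc, comp_whiskerRight, Category.assoc,
    MonoidalCategory.tensorHom_def, whisker_exchange_assoc, whisker_exchange_assoc,
    Category.assoc]

lemma eUnitComp_map {x y z : C} (f : 𝟙_ V ⟶ (x ⟶[V] y)) (g : 𝟙_ V ⟶ (y ⟶[V] z)) :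
    eUnitComp f g ≫ F.map x z = eUnitComp (f ≫ F.map x y) (g ≫ F.map y z) := by
  rw [eUnitComp_eq_ePost, Category.assoc, ePost_map, eUnitComp_eq_ePost, Category.assoc]

end Aux

variable {C : Type w₁} [EnrichedCategory V C] {D : Type w₂} [EnrichedCategory V D]

/-- `V`-natural transformations. -/
@[ext]
structure VNatTrans (F G : EnrichedFunctor V C D) where
  /-- the component at `x`, a morphism of the underlying category -/
  app (x : C) : 𝟙_ V ⟶ (F.obj x ⟶[V] G.obj x)
  naturality (x y : C) :
    (ρ_ _).inv ≫ (F.map x y ⊗ₘ app y) ≫ eComp V (F.obj x) (F.obj y) (G.obj y) =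
      (λ_ _).inv ≫ (app x ⊗ₘ G.map x y) ≫ eComp V (F.obj x) (G.obj x) (G.obj y)

namespace VNatTrans

lemma naturality_iff {F G : EnrichedFunctor V C D} (x y : C)
    (a : 𝟙_ V ⟶ (F.obj x ⟶[V] G.obj x)) (b : 𝟙_ V ⟶ (F.obj y ⟶[V] G.obj y)) :
    (ρ_ _).inv ≫ (F.map x y ⊗ₘ b) ≫ eComp V (F.obj x) (F.obj y) (G.obj y) =
      (λ_ _).inv ≫ (a ⊗ₘ G.map x y) ≫ eComp V (F.obj x) (G.obj x) (G.obj y) ↔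
    F.map x y ≫ ePost (F.obj x) b = G.map x y ≫ ePre a (G.obj y) := by
  rw [ePost, ePre, MonoidalCategory.tensorHom_def, MonoidalCategory.tensorHom_def',
    rightUnitor_inv_naturality_assoc, leftUnitor_inv_naturality_assoc,
    Category.assoc, Category.assoc]

lemma post_eq_pre {F G : EnrichedFunctor V C D} (α : VNatTrans F G) (x y : C) :
    F.map x y ≫ ePost (F.obj x) (α.app y) = G.map x y ≫ ePre (α.app x) (G.obj y) :=
  (naturality_iff x y _ _).1 (α.naturality x y)

/-- The identity transformation. -/
def id (F : EnrichedFunctor V C D) : VNatTrans F F where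
  app x := eId V (F.obj x)
  naturality x y := by rw [naturality_iff]; simp

/-- Vertical composition. -/
def vcomp {F G H : EnrichedFunctor V C D} (α : VNatTrans F G) (β : VNatTrans G H) :
    VNatTrans F H where
  app x := eUnitComp (α.app x) (β.app x)
  naturality x y := by
    rw [naturality_iff, ePost_eUnitComp, ePre_eUnitComp, ← Category.assoc, α.post_eq_pre,
      Category.assoc, ← ePost_comp_ePre, ← Category.assoc, β.post_eq_pre, Category.assoc]

variable {E : Type w₃} [EnrichedCategory V E]

/-- Whiskering with a `V`-functor applied first. -/
def whiskerLeft (F : EnrichedFunctor V C D) {G H : EnrichedFunctor V D E} (α : VNatTrans G H) :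
    VNatTrans (F.comp V G) (F.comp V H) where
  app x := α.app (F.obj x)
  naturality x y := by
    refine (naturality_iff (F := F.comp V G) (G := F.comp V H) x y _ _).2 ?_
    change (F.map x y ≫ G.map _ _) ≫ ePost (G.obj (F.obj x)) (α.app (F.obj y)) =
      (F.map x y ≫ H.map _ _) ≫ ePre (α.app (F.obj x)) (H.obj (F.obj y))
    rw [Category.assoc, Category.assoc, α.post_eq_pre]

/-- Whiskering with a `V`-functor applied afterwards. -/
def whiskerRight {F G : EnrichedFunctor V C D} (α : VNatTrans F G) (H : EnrichedFunctor V D E) :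
    VNatTrans (F.comp V H) (G.comp V H) where
  app x := α.app x ≫ H.map (F.obj x) (G.obj x)
  naturality x y := by
    refine (naturality_iff (F := F.comp V H) (G := G.comp V H) x y _ _).2 ?_
    change (F.map x y ≫ H.map _ _) ≫ ePost (H.obj (F.obj x)) (α.app y ≫ H.map _ _) =
      (G.map x y ≫ H.map _ _) ≫ ePre (α.app x ≫ H.map _ _) (H.obj (G.obj y))
    rw [Category.assoc, Category.assoc, ← ePost_map, ← ePre_map, ← Category.assoc,
      α.post_eq_pre, Category.assoc]

end VNatTrans

/-- `V`-categories (with objects in a fixed universe). -/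
structure VCat (V : Type u) [Category.{v} V] [MonoidalCategory V] : Type (max u v (w + 1)) where
  /-- the class of objects -/
  carrier : Type w
  [str : EnrichedCategory V carrier]

attribute [instance] VCat.str

namespace VCat

/-- 1-cells: `V`-functors. -/
@[ext]
structure Hom (A B : VCat.{w} V) where
  /-- the underlying `V`-functor -/
  functor : EnrichedFunctor V A.carrier B.carrier

/-- 2-cells: `V`-natural transformations. -/
@[ext]
structure Hom₂ {A B : VCat.{w} V} (F G : Hom A B) where
  /-- the underlying `V`-natural transformation -/
  natTrans : VNatTrans F.functor G.functor

instance (A B : VCat.{w} V) : Category (Hom A B) where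
  Hom F G := Hom₂ F G
  id F := ⟨VNatTrans.id F.functor⟩
  comp α β := ⟨α.natTrans.vcomp β.natTrans⟩
  id_comp α := by ext x; simp [VNatTrans.vcomp, VNatTrans.id]
  comp_id α := by ext x; simp [VNatTrans.vcomp, VNatTrans.id]
  assoc α β γ := by ext x; simp [VNatTrans.vcomp, eUnitComp_assoc]

instance : CategoryStruct (VCat.{w} V) where
  Hom A B := Hom A B
  id A := ⟨EnrichedFunctor.id V A.carrier⟩
  comp F G := ⟨F.functor.comp V G.functor⟩

instance homCategory (A B : VCat.{w} V) : Category (A ⟶ B) :=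
  inferInstanceAs (Category (Hom A B))

@[simp] lemma id_functor (A : VCat.{w} V) :
    Hom.functor (𝟙 A) = EnrichedFunctor.id V A.carrier := rfl

@[simp] lemma comp_functor {A B C : VCat.{w} V} (F : A ⟶ B) (G : B ⟶ C) :
    Hom.functor (F ≫ G) = (Hom.functor F).comp V (Hom.functor G) := rfl

/-- The component of a 2-cell. -/
def app {A B : VCat.{w} V} {F G : A ⟶ B} (α : F ⟶ G) (x : A.carrier) :
    𝟙_ V ⟶ (F.functor.obj x ⟶[V] G.functor.obj x) :=
  (Hom₂.natTrans α).app x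

lemma hom_ext₂ {A B : VCat.{w} V} {F G : A ⟶ B} {α β : F ⟶ G} (h : ∀ x, app α x = app β x) :
    α = β :=
  Hom₂.ext (VNatTrans.ext (funext h))

@[simp] lemma app_id {A B : VCat.{w} V} (F : A ⟶ B) (x : A.carrier) :
    app (𝟙 F) x = eId V (F.functor.obj x) := rfl

@[simp] lemma app_comp {A B : VCat.{w} V} {F G H : A ⟶ B} (α : F ⟶ G) (β : G ⟶ H)
    (x : A.carrier) : app (α ≫ β) x = eUnitComp (app α x) (app β x) := rfl

/-- Associativity of composition of `V`-functors; all components are identities. -/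
def associator {A B C D : VCat.{w} V} (F : A ⟶ B) (G : B ⟶ C) (H : C ⟶ D) :
    (F ≫ G) ≫ H ≅ F ≫ G ≫ H where
  hom := ⟨fun x => eId V (H.functor.obj (G.functor.obj (F.functor.obj x))), fun x y => by
    refine (VNatTrans.naturality_iff (F := ((F ≫ G) ≫ H).functor)
      (G := (F ≫ G ≫ H).functor) x y _ _).2 ?_
    erw [ePost_id, ePre_id]
    exact congrArg (· ≫ 𝟙 _) (Category.assoc _ _ _)⟩
  inv := ⟨fun x => eId V (H.functor.obj (G.functor.obj (F.functor.obj x))), fun x y => by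
    refine (VNatTrans.naturality_iff (F := (F ≫ G ≫ H).functor)
      (G := ((F ≫ G) ≫ H).functor) x y _ _).2 ?_
    erw [ePost_id, ePre_id]
    exact congrArg (· ≫ 𝟙 _) (Category.assoc _ _ _).symm⟩
  hom_inv_id := hom_ext₂ fun x => eUnitComp_id _
  inv_hom_id := hom_ext₂ fun x => eUnitComp_id _

/-- The left unit law; all components are identities. -/
def leftUnitor {A B : VCat.{w} V} (F : A ⟶ B) : 𝟙 A ≫ F ≅ F where
  hom := ⟨fun x => eId V (F.functor.obj x), fun x y => by
    refine (VNatTrans.naturality_iff (F := (𝟙 A ≫ F).functor) (G := F.functor) x y _ _).2 ?_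
    erw [ePost_id, ePre_id]
    exact congrArg (· ≫ 𝟙 _) (Category.id_comp _)⟩
  inv := ⟨fun x => eId V (F.functor.obj x), fun x y => by
    refine (VNatTrans.naturality_iff (F := F.functor) (G := (𝟙 A ≫ F).functor) x y _ _).2 ?_
    erw [ePost_id, ePre_id]
    exact congrArg (· ≫ 𝟙 _) (Category.id_comp _).symm⟩
  hom_inv_id := hom_ext₂ fun x => eUnitComp_id _
  inv_hom_id := hom_ext₂ fun x => eUnitComp_id _

/-- The right unit law; all components are identities. -/
def rightUnitor {A B : VCat.{w} V} (F : A ⟶ B) : F ≫ 𝟙 B ≅ F where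
  hom := ⟨fun x => eId V (F.functor.obj x), fun x y => by
    refine (VNatTrans.naturality_iff (F := (F ≫ 𝟙 B).functor) (G := F.functor) x y _ _).2 ?_
    erw [ePost_id, ePre_id]
    exact congrArg (· ≫ 𝟙 _) (Category.comp_id _)⟩
  inv := ⟨fun x => eId V (F.functor.obj x), fun x y => by
    refine (VNatTrans.naturality_iff (F := F.functor) (G := (F ≫ 𝟙 B).functor) x y _ _).2 ?_
    erw [ePost_id, ePre_id]
    exact congrArg (· ≫ 𝟙 _) (Category.comp_id _).symm⟩
  hom_inv_id := hom_ext₂ fun x => eUnitComp_id _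
  inv_hom_id := hom_ext₂ fun x => eUnitComp_id _

/-- The 2-category of `V`-categories, `V`-functors and `V`-natural transformations. -/
instance bicategory : Bicategory (VCat.{w} V) where
  homCategory := homCategory
  whiskerLeft F _ _ α := ⟨α.natTrans.whiskerLeft F.functor⟩
  whiskerRight α H := ⟨α.natTrans.whiskerRight H.functor⟩
  associator := associator
  leftUnitor := leftUnitor
  rightUnitor := rightUnitor
  whiskerLeft_id _ _ := rfl
  whiskerLeft_comp _ _ _ _ _ _ := rfl
  id_whiskerLeft _ := hom_ext₂ fun _ => ((id_eUnitComp _).trans (eUnitComp_id _)).symm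
  comp_whiskerLeft _ _ _ _ _ := hom_ext₂ fun _ =>
    ((id_eUnitComp _).trans (eUnitComp_id _)).symm
  id_whiskerRight _ G := hom_ext₂ fun _ => G.functor.map_id _
  comp_whiskerRight _ _ H := hom_ext₂ fun _ => eUnitComp_map H.functor _ _
  whiskerRight_id _ := hom_ext₂ fun _ =>
    (Category.comp_id _).trans ((id_eUnitComp _).trans (eUnitComp_id _)).symm
  whiskerRight_comp _ _ _ := hom_ext₂ fun _ =>
    (Category.assoc _ _ _).symm.trans ((id_eUnitComp _).trans (eUnitComp_id _)).symm
  whisker_assoc _ _ _ _ _ := hom_ext₂ fun _ => ((id_eUnitComp _).trans (eUnitComp_id _)).symm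
  whisker_exchange {A B C F G H K} α β := hom_ext₂ fun x => by
    change eUnitComp (app β (F.functor.obj x)) (app α x ≫ K.functor.map _ _) =
      eUnitComp (app α x ≫ H.functor.map _ _) (app β (G.functor.obj x))
    rw [eUnitComp_eq_ePre, eUnitComp_eq_ePost, Category.assoc, Category.assoc]
    exact congrArg _ ((Hom₂.natTrans β).post_eq_pre _ _).symm
  pentagon _ _ _ K := hom_ext₂ fun _ => by
    refine (congrArg₂ eUnitComp (K.functor.map_id _) (eUnitComp_id _)).trans ?_
    rfl
  triangle _ G := hom_ext₂ fun _ => (eUnitComp_id _).trans (G.functor.map_id _).symm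

end VCat

end VCat


/-! ### The two classes of `V`-functors -/

section Classes

universe w v u

variable {V : Type u} [Category.{v} V] [MonoidalCategory V]

/-- The `V`-fully faithful functors: all maps on hom-objects are isomorphisms. -/
def fullyFaithful : MorphismProperty (VCat.{w} V) :=
  fun A _ F => ∀ x y : A.carrier, IsIso (F.functor.map x y)

/-- The essentially surjective `V`-functors: every object of the codomain is isomorphic, in the
underlying category, to a value. -/
def essSurj : MorphismProperty (VCat.{w} V) :=
  fun _ _ F => F.functor.forget.EssSurj

end Classes

/-! ### Tensor products of `V`-categories and `V`-profunctors -/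

section Tensor

universe v u w₁ w₂

variable {V : Type u} [Category.{v} V] [MonoidalCategory V] [BraidedCategory V]

/-- Objects of the tensor product `C ⊗ D` of `V`-categories. -/
@[ext]
structure TensorObj (C : Type w₁) (D : Type w₂) where
  /-- the first component -/
  fst : C
  /-- the second component -/
  snd : D

variable {C : Type w₁} [EnrichedCategory V C] {D : Type w₂} [EnrichedCategory V D]

lemma tensorμ_unit_inner (X Y : V) :
    ((ρ_ X).inv ⊗ₘ (λ_ Y).inv) ≫ tensorμ X (𝟙_ V) (𝟙_ V) Y ≫ ((ρ_ X).hom ⊗ₘ (λ_ Y).hom) =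
      𝟙 _ := by
  simp only [tensorμ, braiding_tensorUnit_left]
  monoidal

lemma tensorμ_unit_outer (X Y : V) :
    ((λ_ Y).inv ⊗ₘ (ρ_ X).inv) ≫ tensorμ (𝟙_ V) Y X (𝟙_ V) ≫ ((λ_ X).hom ⊗ₘ (ρ_ Y).hom) =
      (β_ Y X).hom := by
  simp only [tensorμ]
  monoidal

/-- The tensor product of `V`-categories. -/
instance tensorEnriched : EnrichedCategory V (TensorObj C D) where
  Hom x y := (x.fst ⟶[V] y.fst) ⊗ (x.snd ⟶[V] y.snd)
  id x := (λ_ (𝟙_ V)).inv ≫ (eId V x.fst ⊗ₘ eId V x.snd)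
  comp x y z := tensorμ _ _ _ _ ≫ (eComp V x.fst y.fst z.fst ⊗ₘ eComp V x.snd y.snd z.snd)
  id_comp x y := by
    have h := tensor_left_unitality (x.fst ⟶[V] y.fst) (x.snd ⟶[V] y.snd)
    rw [Iso.inv_comp_eq, comp_whiskerRight, Category.assoc, tensorμ_natural_left_assoc,
      tensorHom_comp_tensorHom, Category.comp_id, h]
    have h₁ := e_id_comp V x.fst y.fst
    have h₂ := e_id_comp V x.snd y.snd
    rw [Iso.inv_comp_eq, Category.comp_id] at h₁ h₂
    rw [h₁, h₂]
  comp_id x y := by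
    have h := tensor_right_unitality (x.fst ⟶[V] y.fst) (x.snd ⟶[V] y.snd)
    rw [Iso.inv_comp_eq, MonoidalCategory.whiskerLeft_comp, Category.assoc,
      tensorμ_natural_right_assoc, tensorHom_comp_tensorHom, Category.comp_id, h]
    have h₁ := e_comp_id V x.fst y.fst
    have h₂ := e_comp_id V x.snd y.snd
    rw [Iso.inv_comp_eq, Category.comp_id] at h₁ h₂
    rw [h₁, h₂]
  assoc x y z t := by
    rw [Iso.inv_comp_eq, comp_whiskerRight, Category.assoc, tensorμ_natural_left_assoc,
      tensorHom_comp_tensorHom, MonoidalCategory.whiskerLeft_comp, Category.assoc,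
      tensorμ_natural_right_assoc, tensorHom_comp_tensorHom]
    rw [← e_assoc' V x.fst, ← e_assoc' V x.snd, ← tensorHom_comp_tensorHom,
      tensor_associativity_assoc]

/-- The `V`-functor `(c, -) : D ⥤ C ⊗ D`. -/
def fixLeft (c : C) : EnrichedFunctor V D (TensorObj C D) where
  obj d := ⟨c, d⟩
  map d d' := (λ_ _).inv ≫ eId V c ▷ (d ⟶[V] d')
  map_id d := by
    rw [leftUnitor_inv_naturality_assoc, ← MonoidalCategory.tensorHom_def']
    rfl
  map_comp x y z := by
    have hc : (eId V c ⊗ₘ eId V c) ≫ eComp V c c c = (λ_ _).hom ≫ eId V c := by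
      have h := e_id_comp V c c
      rw [Iso.inv_comp_eq, Category.comp_id] at h
      rw [MonoidalCategory.tensorHom_def', Category.assoc, h, leftUnitor_naturality]
    change _ = (((λ_ _).inv ≫ eId V c ▷ (x ⟶[V] y)) ⊗ₘ ((λ_ _).inv ≫ eId V c ▷ (y ⟶[V] z))) ≫
      tensorμ _ _ _ _ ≫ (eComp V c c c ⊗ₘ eComp V x y z)
    have hμ : ((λ_ (x ⟶[V] y)).inv ⊗ₘ (λ_ (y ⟶[V] z)).inv) ≫ tensorμ _ _ _ _ =
        (λ_ _).inv ≫ (λ_ (𝟙_ V)).inv ▷ _ := by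
      simp only [tensorμ, braiding_tensorUnit_right]
      monoidal
    rw [← tensorHom_comp_tensorHom, ← tensorHom_id, ← tensorHom_id, ← tensorHom_id,
      Category.assoc, tensorμ_natural_assoc, tensorHom_comp_tensorHom, hc, id_tensorHom_id,
      Category.id_comp, reassoc_of% hμ, leftUnitor_inv_naturality_assoc, tensorHom_id,
      MonoidalCategory.tensorHom_def', comp_whiskerRight, whisker_exchange_assoc,
      inv_hom_whiskerRight_assoc]

/-- The `V`-functor `(-, d) : C ⥤ C ⊗ D`. -/
def fixRight (d : D) : EnrichedFunctor V C (TensorObj C D) where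
  obj c := ⟨c, d⟩
  map c c' := (ρ_ _).inv ≫ (c ⟶[V] c') ◁ eId V d
  map_id c := by
    rw [rightUnitor_inv_naturality_assoc, ← MonoidalCategory.tensorHom_def, ← unitors_inv_equal]
    rfl
  map_comp x y z := by
    have hd : (eId V d ⊗ₘ eId V d) ≫ eComp V d d d = (λ_ _).hom ≫ eId V d := by
      have h := e_id_comp V d d
      rw [Iso.inv_comp_eq, Category.comp_id] at h
      rw [MonoidalCategory.tensorHom_def', Category.assoc, h, leftUnitor_naturality]
    have hμ : ((ρ_ (x ⟶[V] y)).inv ⊗ₘ (ρ_ (y ⟶[V] z)).inv) ≫ tensorμ _ _ _ _ =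
        (ρ_ _).inv ≫ _ ◁ (λ_ (𝟙_ V)).inv := by
      simp only [tensorμ, braiding_tensorUnit_left]
      monoidal
    change _ = (((ρ_ _).inv ≫ (x ⟶[V] y) ◁ eId V d) ⊗ₘ ((ρ_ _).inv ≫ (y ⟶[V] z) ◁ eId V d)) ≫
      tensorμ _ _ _ _ ≫ (eComp V x y z ⊗ₘ eComp V d d d)
    rw [← tensorHom_comp_tensorHom, ← id_tensorHom, ← id_tensorHom, ← id_tensorHom,
      Category.assoc, tensorμ_natural_assoc, tensorHom_comp_tensorHom, hd, id_tensorHom_id,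
      Category.id_comp, reassoc_of% hμ, rightUnitor_inv_naturality_assoc, id_tensorHom,
      MonoidalCategory.tensorHom_def, MonoidalCategory.whiskerLeft_comp, ← whisker_exchange_assoc,
      whiskerLeft_inv_hom_assoc]

lemma fixRight_comp_fixLeft {c c' : C} {d d' : D} :
    ((fixRight (V := V) d).map c c' ⊗ₘ (fixLeft (V := V) c').map d d') ≫
      eComp V (⟨c, d⟩ : TensorObj C D) ⟨c', d⟩ ⟨c', d'⟩ = 𝟙 _ := by
  change (((ρ_ _).inv ≫ (c ⟶[V] c') ◁ eId V d) ⊗ₘ ((λ_ _).inv ≫ eId V c' ▷ (d ⟶[V] d'))) ≫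
    tensorμ _ _ _ _ ≫ (eComp V c c' c' ⊗ₘ eComp V d d d') = 𝟙 _
  have h₁ := e_comp_id V c c'
  have h₂ := e_id_comp V d d'
  rw [Iso.inv_comp_eq, Category.comp_id] at h₁ h₂
  rw [← tensorHom_comp_tensorHom, Category.assoc, ← id_tensorHom, ← tensorHom_id,
    tensorμ_natural_assoc, tensorHom_comp_tensorHom, id_tensorHom, tensorHom_id, h₁, h₂,
    tensorμ_unit_inner]

lemma fixLeft_comp_fixRight {c c' : C} {d d' : D} :
    ((fixLeft (V := V) c).map d d' ⊗ₘ (fixRight (V := V) d').map c c') ≫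
      eComp V (⟨c, d⟩ : TensorObj C D) ⟨c, d'⟩ ⟨c', d'⟩ = (β_ _ _).hom := by
  change (((λ_ _).inv ≫ eId V c ▷ (d ⟶[V] d')) ⊗ₘ ((ρ_ _).inv ≫ (c ⟶[V] c') ◁ eId V d')) ≫
    tensorμ _ _ _ _ ≫ (eComp V c c c' ⊗ₘ eComp V d d' d') = _
  have h₁ := e_id_comp V c c'
  have h₂ := e_comp_id V d d'
  rw [Iso.inv_comp_eq, Category.comp_id] at h₁ h₂
  rw [← tensorHom_comp_tensorHom, Category.assoc, ← id_tensorHom, ← tensorHom_id,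
    tensorμ_natural_assoc, tensorHom_comp_tensorHom, id_tensorHom, tensorHom_id, h₁, h₂,
    tensorμ_unit_outer]

end Tensor

section Collage

universe w v u w₁ w₂

variable {V : Type u} [Category.{v} V] [MonoidalCategory V] [SymmetricCategory V]
  [MonoidalClosed V]

open scoped MonoidalClosed

set_option linter.unusedSectionVars false

/-- A `V`-profunctor from `A` to `B`: a `V`-functor `Bᵒᵖ ⊗ A ⥤ V`. -/
abbrev VProfunctor (A B : VCat.{w} V) :=
  EnrichedFunctor V (TensorObj B.carrierᵒᵖ A.carrier) V

variable {C : Type w₁} [EnrichedCategory V C]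

lemma uncurry_tensorHom_comp {a b c X Y : V} (f : X ⟶ (ihom a).obj b) (g : Y ⟶ (ihom b).obj c) :
    MonoidalClosed.uncurry ((f ⊗ₘ g) ≫ MonoidalClosed.comp a b c) =
      (α_ _ _ _).inv ≫ MonoidalClosed.uncurry f ▷ _ ≫ MonoidalClosed.uncurry g := by
  rw [MonoidalClosed.uncurry_natural_left, MonoidalClosed.comp_eq,
    MonoidalClosed.uncurry_curry, MonoidalClosed.compTranspose_eq, MonoidalClosed.uncurry_eq,
    MonoidalClosed.uncurry_eq, MonoidalCategory.tensorHom_def]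
  simp only [MonoidalCategory.whiskerLeft_comp, comp_whiskerRight, Category.assoc,
    associator_inv_naturality_right_assoc, associator_inv_naturality_middle_assoc,
    whisker_exchange_assoc]
  rfl

/-- The action `P(c) ⊗ C(c, c') ⟶ P(c')` of a `V`-functor `P : C ⥤ V`. -/
def act (P : EnrichedFunctor V C V) (c c' : C) : P.obj c ⊗ (c ⟶[V] c') ⟶ P.obj c' :=
  MonoidalClosed.uncurry (P.map c c')

lemma act_id (P : EnrichedFunctor V C V) (c : C) :
    P.obj c ◁ eId V c ≫ act P c c = (ρ_ _).hom := by
  rw [act, ← MonoidalClosed.uncurry_natural_left, P.map_id]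
  exact MonoidalClosed.uncurry_curry _

lemma act_comp (P : EnrichedFunctor V C V) (c c' c'' : C) :
    P.obj c ◁ eComp V c c' c'' ≫ act P c c'' =
      (α_ _ _ _).inv ≫ act P c c' ▷ _ ≫ act P c' c'' := by
  rw [act, ← MonoidalClosed.uncurry_natural_left, P.map_comp]
  exact uncurry_tensorHom_comp _ _

lemma id_action_aux {M X : V} (i : 𝟙_ V ⟶ X) (l : M ⊗ X ⟶ M) (h : M ◁ i ≫ l = (ρ_ M).hom) :
    (λ_ M).inv ≫ i ▷ M ≫ (β_ X M).hom ≫ l = 𝟙 M := by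
  rw [BraidedCategory.braiding_naturality_left_assoc, leftUnitor_inv_braiding_assoc, h,
    Iso.inv_hom_id]

lemma left_action_aux {M₀ M₁ M₂ X Y Z : V} (c : X ⊗ Y ⟶ Z) (l : M₀ ⊗ Y ⟶ M₁) (l' : M₁ ⊗ X ⟶ M₂)
    (l'' : M₀ ⊗ Z ⟶ M₂)
    (h : M₀ ◁ ((β_ Y X).hom ≫ c) ≫ l'' = (α_ M₀ Y X).inv ≫ l ▷ X ≫ l') :
    (α_ X Y M₀).inv ≫ c ▷ M₀ ≫ (β_ Z M₀).hom ≫ l'' =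
      X ◁ ((β_ Y M₀).hom ≫ l) ≫ (β_ X M₁).hom ≫ l' := by
  rw [Iso.eq_inv_comp, MonoidalCategory.whiskerLeft_comp, Category.assoc] at h
  rw [BraidedCategory.braiding_naturality_left_assoc, MonoidalCategory.whiskerLeft_comp,
    Category.assoc, BraidedCategory.braiding_naturality_right_assoc, ← h,
    BraidedCategory.braiding_tensor_left_hom, BraidedCategory.braiding_tensor_right_hom]
  simp only [Category.assoc, Iso.inv_hom_id_assoc]
  simp only [← MonoidalCategory.whiskerLeft_comp_assoc, SymmetricCategory.symmetry_assoc]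

lemma bimodule_aux {M M₁ M₂ N X Y : V} (l : M ⊗ X ⟶ M₁) (r : M₁ ⊗ Y ⟶ N) (r' : M ⊗ Y ⟶ M₂)
    (l' : M₂ ⊗ X ⟶ N) (t : M ⊗ (X ⊗ Y) ⟶ N) (h₁ : (α_ _ _ _).inv ≫ l ▷ Y ≫ r = t)
    (h₂ : (α_ _ _ _).inv ≫ r' ▷ X ≫ l' = M ◁ (β_ Y X).hom ≫ t) :
    (α_ X M Y).inv ≫ ((β_ X M).hom ≫ l) ▷ Y ≫ r = X ◁ r' ≫ (β_ X M₂).hom ≫ l' := by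
  rw [Iso.inv_comp_eq] at h₁ h₂
  rw [BraidedCategory.braiding_naturality_right_assoc, h₂,
    BraidedCategory.braiding_tensor_right_hom, comp_whiskerRight, Category.assoc, h₁]
  simp only [Category.assoc, Iso.inv_hom_id_assoc]
  rw [← MonoidalCategory.whiskerLeft_comp_assoc, SymmetricCategory.symmetry]
  simp

lemma act_comp_functor {D : Type w₂} [EnrichedCategory V D] (F : EnrichedFunctor V D C)
    (P : EnrichedFunctor V C V) (d d' : D) :
    act (F.comp V P) d d' = P.obj (F.obj d) ◁ F.map d d' ≫ act P (F.obj d) (F.obj d') :=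
  MonoidalClosed.uncurry_natural_left _ _

lemma act_aux (P : EnrichedFunctor V C V) {c c' c'' : C} {X Y : V} (f : X ⟶ (c ⟶[V] c'))
    (g : Y ⟶ (c' ⟶[V] c'')) {k : X ⊗ Y ⟶ (c ⟶[V] c'')} (h : (f ⊗ₘ g) ≫ eComp V c c' c'' = k) :
    (α_ _ _ _).inv ≫ (P.obj c ◁ f ≫ act P c c') ▷ Y ≫ P.obj c' ◁ g ≫ act P c' c'' =
      P.obj c ◁ k ≫ act P c c'' := by
  rw [← h, MonoidalCategory.whiskerLeft_comp, Category.assoc, act_comp,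
    MonoidalCategory.tensorHom_def]
  simp only [MonoidalCategory.whiskerLeft_comp, comp_whiskerRight, Category.assoc,
    associator_inv_naturality_right_assoc, associator_inv_naturality_middle_assoc,
    whisker_exchange_assoc]

/-- Objects `M(b, a)` of `V` with compatible actions of `B` on the left and of `A` on the right. -/
structure Bimodule (A B : VCat.{w} V) where
  /-- the object `M(b, a)` -/
  obj : B.carrier → A.carrier → V
  /-- the left action of `B` -/
  lact (b' b : B.carrier) (a : A.carrier) : (b' ⟶[V] b) ⊗ obj b a ⟶ obj b' a
  /-- the right action of `A` -/
  ract (b : B.carrier) (a a' : A.carrier) : obj b a ⊗ (a ⟶[V] a') ⟶ obj b a'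
  id_lact (b : B.carrier) (a : A.carrier) : (λ_ _).inv ≫ eId V b ▷ _ ≫ lact b b a = 𝟙 _
  ract_id (b : B.carrier) (a : A.carrier) : (ρ_ _).inv ≫ _ ◁ eId V a ≫ ract b a a = 𝟙 _
  lact_lact (b'' b' b : B.carrier) (a : A.carrier) :
    (α_ _ _ _).inv ≫ eComp V b'' b' b ▷ _ ≫ lact b'' b a = _ ◁ lact b' b a ≫ lact b'' b' a
  ract_ract (b : B.carrier) (a a' a'' : A.carrier) :
    (α_ _ _ _).inv ≫ ract b a a' ▷ _ ≫ ract b a' a'' = _ ◁ eComp V a a' a'' ≫ ract b a a''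
  lact_ract (b' b : B.carrier) (a a' : A.carrier) :
    (α_ _ _ _).inv ≫ lact b' b a ▷ _ ≫ ract b' a a' = _ ◁ ract b a a' ≫ lact b' b a'

section

variable {A B : VCat.{w} V} (P : VProfunctor A B)

/-- The bimodule with `M(b, a) = P(b, a)` and the actions transposed from the partial `V`-functors
`P(-, a) : Bᵒᵖ ⥤ V` and `P(b, -) : A ⥤ V`. -/
def VProfunctor.toBimodule : Bimodule A B where
  obj b a := P.obj ⟨.op b, a⟩
  lact b' b a := (β_ _ _).hom ≫ act ((fixRight (V := V) a).comp V P) (Opposite.op b) (Opposite.op b')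
  ract b a a' := act ((fixLeft (V := V) (Opposite.op b)).comp V P) a a'
  id_lact b a :=
    id_action_aux _ _ (act_id ((fixRight (V := V) a).comp V P) (Opposite.op b))
  ract_id b a := by
    rw [Iso.inv_comp_eq, Category.comp_id]
    exact act_id ((fixLeft (V := V) (Opposite.op b)).comp V P) a
  lact_lact b'' b' b a := left_action_aux _ _ _ _
    (act_comp ((fixRight (V := V) a).comp V P) (Opposite.op b) (Opposite.op b') (Opposite.op b''))
  ract_ract b a a' a'' := (act_comp ((fixLeft (V := V) (Opposite.op b)).comp V P) a a' a'').symm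
  lact_ract b' b a a' := by
    refine bimodule_aux _ _ _ _ (act P ⟨Opposite.op b, a⟩ ⟨Opposite.op b', a'⟩) ?_ ?_
    · rw [act_comp_functor, act_comp_functor]
      refine (act_aux P _ _ (fixRight_comp_fixLeft (V := V) (c := Opposite.op b)
        (c' := Opposite.op b') (d := a) (d' := a'))).trans ?_
      exact (congrArg (· ≫ _) (MonoidalCategory.whiskerLeft_id _ _)).trans (Category.id_comp _)
    · rw [act_comp_functor, act_comp_functor]
      exact act_aux P _ _ (fixLeft_comp_fixRight (V := V) (c := Opposite.op b)
        (c' := Opposite.op b') (d := a) (d' := a'))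

end

/-! ### Collages and coproducts -/

variable [HasInitial V]

lemma tensor_initial_hom_ext {X Y : V} (f g : X ⊗ (⊥_ V) ⟶ Y) : f = g :=
  MonoidalClosed.curry_injective (initialIsInitial.hom_ext _ _)

lemma initial_tensor_hom_ext {X Y : V} (f g : (⊥_ V) ⊗ X ⟶ Y) : f = g := by
  rw [← cancel_epi (β_ X (⊥_ V)).hom]
  exact tensor_initial_hom_ext _ _

lemma tensor_tensor_initial_hom_ext {W X Y : V} (f g : W ⊗ X ⊗ (⊥_ V) ⟶ Y) : f = g := by
  rw [← cancel_epi (α_ W X (⊥_ V)).hom]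
  exact tensor_initial_hom_ext _ _

lemma tensor_initial_tensor_hom_ext {W X Y : V} (f g : W ⊗ (⊥_ V) ⊗ X ⟶ Y) : f = g :=
  MonoidalClosed.curry_injective (initial_tensor_hom_ext _ _)

/-- The unique morphism out of `X ⊗ ∅`. -/
noncomputable def tensorInitialTo (X Y : V) : X ⊗ (⊥_ V) ⟶ Y :=
  MonoidalClosed.uncurry (initial.to _)

/-- The unique morphism out of `∅ ⊗ X`. -/
noncomputable def initialTensorTo (X Y : V) : (⊥_ V) ⊗ X ⟶ Y :=
  (β_ _ _).hom ≫ tensorInitialTo X Y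

lemma id_map_comp_aux {X Y Z : V} (f : X ⊗ Y ⟶ Z) : f ≫ 𝟙 Z = (𝟙 X ⊗ₘ 𝟙 Y) ≫ f := by simp

namespace Bimodule

variable {A B : VCat.{w} V} (M : Bimodule A B)

/-- The hom-objects `E(b', b) = B(b', b)`, `E(b, a) = M(b, a)`, `E(a, a') = A(a, a')` and
`E(a, b) = ∅` of the collage. -/
noncomputable def collageHom : A.carrier ⊕ B.carrier → A.carrier ⊕ B.carrier → V
  | .inl a, .inl a' => a ⟶[V] a'
  | .inr b, .inl a => M.obj b a
  | .inr b', .inr b => b' ⟶[V] b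
  | .inl _, .inr _ => ⊥_ V

/-- Identities of the collage. -/
def collageId : ∀ x : A.carrier ⊕ B.carrier, 𝟙_ V ⟶ M.collageHom x x
  | .inl a => eId V a
  | .inr b => eId V b

/-- Composition in the collage: that of `A` and of `B`, and the actions on `M`. -/
noncomputable def collageComp : ∀ x y z : A.carrier ⊕ B.carrier,
    M.collageHom x y ⊗ M.collageHom y z ⟶ M.collageHom x z
  | .inl a, .inl a', .inl a'' => eComp V a a' a''
  | .inr b, .inl a, .inl a' => M.ract b a a'
  | .inr b', .inr b, .inl a => M.lact b' b a
  | .inr b'', .inr b', .inr b => eComp V b'' b' b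
  | .inl _, .inl _, .inr _ => tensorInitialTo _ _
  | .inr _, .inl _, .inr _ => tensorInitialTo _ _
  | .inl _, .inr _, .inl _ => initialTensorTo _ _
  | .inl _, .inr _, .inr _ => initialTensorTo _ _

/-- The collage: the `V`-category with objects `ob A ⊔ ob B` and the above hom-objects. -/
noncomputable def collage : VCat.{w} V where
  carrier := A.carrier ⊕ B.carrier
  str :=
    { Hom := M.collageHom
      id := M.collageId
      comp := M.collageComp
      id_comp := by
        rintro (a | b) (a' | b')
        · exact e_id_comp V a a'
        · exact initialIsInitial.hom_ext _ _
        · exact M.id_lact b a'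
        · exact e_id_comp V b b'
      comp_id := by
        rintro (a | b) (a' | b')
        · exact e_comp_id V a a'
        · exact initialIsInitial.hom_ext _ _
        · exact M.ract_id b a'
        · exact e_comp_id V b b'
      assoc := by
        rintro (x | x) (y | y) (z | z) (t | t)
        · exact e_assoc V x y z t
        · exact tensor_tensor_initial_hom_ext _ _
        · exact tensor_initial_tensor_hom_ext _ _
        · exact tensor_initial_tensor_hom_ext _ _
        · exact initial_tensor_hom_ext _ _
        · exact initial_tensor_hom_ext _ _
        · exact initial_tensor_hom_ext _ _
        · exact initial_tensor_hom_ext _ _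
        · exact M.ract_ract x y z t
        · exact tensor_tensor_initial_hom_ext _ _
        · exact tensor_initial_tensor_hom_ext _ _
        · exact tensor_initial_tensor_hom_ext _ _
        · exact M.lact_ract x y z t
        · exact tensor_tensor_initial_hom_ext _ _
        · exact M.lact_lact x y z t
        · exact e_assoc V x y z t }

/-- The inclusion `A ⟶ E` into the collage. -/
noncomputable def inlCollage : A ⟶ M.collage where
  functor :=
    { obj := Sum.inl
      map := fun a a' => 𝟙 (a ⟶[V] a')
      map_id := fun _ => Category.comp_id _
      map_comp := fun a a' a'' => id_map_comp_aux (eComp V a a' a'') }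

/-- The inclusion `B ⟶ E` into the collage. -/
noncomputable def inrCollage : B ⟶ M.collage where
  functor :=
    { obj := Sum.inr
      map := fun b b' => 𝟙 (b ⟶[V] b')
      map_id := fun _ => Category.comp_id _
      map_comp := fun b b' b'' => id_map_comp_aux (eComp V b b' b'') }

variable (A B) in
/-- The bimodule with all values the initial object. -/
noncomputable def empty : Bimodule A B where
  obj _ _ := ⊥_ V
  lact _ _ _ := tensorInitialTo _ _
  ract _ _ _ := initialTensorTo _ _
  id_lact _ _ := initialIsInitial.hom_ext _ _
  ract_id _ _ := initialIsInitial.hom_ext _ _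
  lact_lact _ _ _ _ := tensor_tensor_initial_hom_ext _ _
  ract_ract _ _ _ _ := by
    rw [Iso.inv_comp_eq]
    rw [← cancel_epi (α_ _ _ _).inv]
    exact initial_tensor_hom_ext _ _
  lact_ract _ _ _ _ := tensor_initial_tensor_hom_ext _ _

end Bimodule

section Coprod

variable (A B : VCat.{w} V)

/-- The coproduct `A ⊔ B` of `V`-categories: the objects are those of `A` and of `B`, the
hom-objects within `A` and within `B` are the given ones, all others are initial. (It is the
collage of the profunctor with all values initial.) -/
noncomputable def coprod : VCat.{w} V := (Bimodule.empty A B).collage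

/-- The first coproduct inclusion. -/
noncomputable def coprodInl : A ⟶ coprod A B := (Bimodule.empty A B).inlCollage

/-- The second coproduct inclusion. -/
noncomputable def coprodInr : B ⟶ coprod A B := (Bimodule.empty A B).inrCollage

variable {A B}

/-- The maps on hom-objects of the `V`-functor `A ⊔ B ⟶ E` induced by `F` and `G`. -/
noncomputable def coprodDescMap {E : VCat.{w} V} (F : A ⟶ E) (G : B ⟶ E) :
    ∀ x y : A.carrier ⊕ B.carrier, (Bimodule.empty A B).collageHom x y ⟶
      (Sum.elim F.functor.obj G.functor.obj x ⟶[V] Sum.elim F.functor.obj G.functor.obj y)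
  | .inl a, .inl a' => F.functor.map a a'
  | .inr b, .inr b' => G.functor.map b b'
  | .inl _, .inr _ => initial.to _
  | .inr _, .inl _ => initial.to _

/-- The 1-cell `A ⊔ B ⟶ E` induced by `F : A ⟶ E` and `G : B ⟶ E`. -/
noncomputable def coprodDesc {E : VCat.{w} V} (F : A ⟶ E) (G : B ⟶ E) : coprod A B ⟶ E where
  functor :=
    { obj := Sum.elim F.functor.obj G.functor.obj
      map := coprodDescMap F G
      map_id := by
        rintro (a | b)
        · exact F.functor.map_id a
        · exact G.functor.map_id b
      map_comp := by
        rintro (x | x) (y | y) (z | z)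
        · exact F.functor.map_comp x y z
        · exact tensor_initial_hom_ext _ _
        · exact initial_tensor_hom_ext _ _
        · exact initial_tensor_hom_ext _ _
        · exact initial_tensor_hom_ext _ _
        · exact tensor_initial_hom_ext _ _
        · exact tensor_initial_hom_ext _ _
        · exact G.functor.map_comp x y z }

lemma coprodInl_desc {E : VCat.{w} V} (F : A ⟶ E) (G : B ⟶ E) :
    coprodInl A B ≫ coprodDesc F G = F :=
  VCat.Hom.ext (EnrichedFunctor.ext V (fun _ => rfl) fun _ _ =>
    (Category.comp_id _).trans (Category.id_comp _))

lemma coprodInr_desc {E : VCat.{w} V} (F : A ⟶ E) (G : B ⟶ E) :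
    coprodInr A B ≫ coprodDesc F G = G :=
  VCat.Hom.ext (EnrichedFunctor.ext V (fun _ => rfl) fun _ _ =>
    (Category.comp_id _).trans (Category.id_comp _))

end Coprod

/-- The collage of the `V`-profunctor `P`. -/
noncomputable def VProfunctor.collage {A B : VCat.{w} V} (P : VProfunctor A B) : VCat.{w} V :=
  (VProfunctor.toBimodule P).collage

/-- The 1-cell `A ⊔ B ⟶ E` induced by the inclusions of `A` and `B` into the collage `E` of `P`. -/
noncomputable def VProfunctor.collageInclusion {A B : VCat.{w} V} (P : VProfunctor A B) :
    coprod A B ⟶ VProfunctor.collage P :=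
  coprodDesc (VProfunctor.toBimodule P).inlCollage (VProfunctor.toBimodule P).inrCollage

/-- The collection of all 1-cells `A ⊔ B ⟶ E` given by the collages of `V`-profunctors. -/
inductive collageInclusions : MorphismProperty (VCat.{w} V)
  | mk {A B : VCat.{w} V} (P : VProfunctor A B) :
      collageInclusions (VProfunctor.collageInclusion P)

end Collage

end EnrichedOFS

universe w v u

namespace EnrichedOFS

/-! ### Essentially surjective 1-cells against fully faithful 1-cells -/

section Orthogonality

universe w₁

variable {V : Type u} [Category.{v} V] [MonoidalCategory V]

/-! Both halves rest on reading the comparison functor into the iso-comma category concretely.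

For the factorization system, every `V`-functor factors strictly through its full image: same
objects as the domain, hom-objects of the codomain. For orthogonality, composition with a fully
faithful `m` is fully faithful on 2-cells (`postcompFullyFaithful`), which makes the comparison
functor fully faithful for any `e`. If `e` is essentially surjective, an object of the iso-comma
category, namely `F`, `G` and `F ≫ m ≅ e ≫ G`, has a diagonal: for each `y` choose `s y` with `e (s
y) ≅ y` and send `y` to `F (s y)`. Then `m (F (s y)) ≅ G (e (s y)) ≅ G y`, and transporting the
action of `G` along these isomorphisms and inverting `m` on hom-objects gives the `V`-functor
(`fullyFaithfulLift`). This half uses only the monoidal structure of `V`.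

For generation, collage inclusions are surjective on objects, hence orthogonal to fully faithful
1-cells. Conversely, it is enough to test on profunctors between unit `V`-categories, that is, on
single objects `K` of `V`. A `V`-functor from such a collage to `Z` amounts to objects `x`, `y` and
a morphism `K ⟶ Z(x, y)`, while its restriction to the coproduct remembers only `x` and `y`.
Orthogonality to `m` therefore makes `Z(x, y) ⟶ W(m x, m y)` bijective on `K`-shaped elements, as in
the Yoneda lemma: fullness of the comparison functor gives injectivity (`eq_of_comp_map_eq`), and
its essential surjectivity at `K = W(m x, m y)` gives a section (`exists_section_map`). -/

lemma ePost_eComp {C : Type w₁} [EnrichedCategory V C] {x y z : C} (f : 𝟙_ V ⟶ (y ⟶[V] z))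
    (t : C) : ePost x f ▷ (z ⟶[V] t) ≫ eComp V x z t =
      (x ⟶[V] y) ◁ ePre f t ≫ eComp V x y t := by
  have h := e_assoc V x y z t
  simp only [ePost, ePre, MonoidalCategory.whiskerLeft_comp, comp_whiskerRight,
    Category.assoc] at h ⊢
  rw [← h]
  simp

/-- Conjugating hom-objects respects composition as soon as the two morphisms inserted at the middle
object cancel. This is the functoriality of the lift constructed below. -/
lemma eComp_ePre_ePost {C : Type w₁} [EnrichedCategory V C] {x x' y y' z z' : C}
    (f : 𝟙_ V ⟶ (x' ⟶[V] x)) (g : 𝟙_ V ⟶ (y' ⟶[V] y)) (g' : 𝟙_ V ⟶ (y ⟶[V] y'))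
    (h : 𝟙_ V ⟶ (z ⟶[V] z')) (hg : eUnitComp g' g = eId V y) :
    eComp V x y z ≫ ePre f z ≫ ePost x' h =
      ((ePre f y ≫ ePost x' g') ⊗ₘ (ePre g z ≫ ePost y' h)) ≫ eComp V x' y' z' := by
  rw [MonoidalCategory.tensorHom_def, comp_whiskerRight, MonoidalCategory.whiskerLeft_comp]
  simp only [Category.assoc]
  rw [← eComp_ePost, ← reassoc_of% ePost_eComp, ← comp_whiskerRight_assoc (ePost x' g'),
    ← ePost_eUnitComp, hg, ePost_id, id_whiskerRight, Category.id_comp, reassoc_of% ePre_eComp]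

namespace VCat

variable {X Y Z W : VCat.{w} V}

lemma app_naturality {F G : X ⟶ Y} (α : F ⟶ G) (x y : X.carrier) :
    F.functor.map x y ≫ ePost (F.functor.obj x) (app α y) =
      G.functor.map x y ≫ ePre (app α x) (G.functor.obj y) :=
  (Hom₂.natTrans α).post_eq_pre x y

lemma app_hom_inv {F G : X ⟶ Y} (α : F ≅ G) (x : X.carrier) :
    eUnitComp (app α.hom x) (app α.inv x) = eId V (F.functor.obj x) := by
  rw [← app_comp, α.hom_inv_id, app_id]

lemma app_inv_hom {F G : X ⟶ Y} (α : F ≅ G) (x : X.carrier) :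
    eUnitComp (app α.inv x) (app α.hom x) = eId V (G.functor.obj x) := by
  rw [← app_comp, α.inv_hom_id, app_id]

/-- Strict equalities of 1-cells serve below as 2-cells. When the values of the two `V`-functors
agree definitionally, the remaining transport is trivial and the component is an identity. -/
lemma app_eqToHom {F G : X ⟶ Y} (h : F = G) (x : X.carrier) :
    app (eqToHom h) x = eId V (F.functor.obj x) ≫ eqToHom (by rw [h]) := by
  subst h; simp

/-- A 2-cell with given components. -/
def mkHom {F G : X ⟶ Y} (a : ∀ x, 𝟙_ V ⟶ (F.functor.obj x ⟶[V] G.functor.obj x))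
    (h : ∀ x y, F.functor.map x y ≫ ePost (F.functor.obj x) (a y) =
      G.functor.map x y ≫ ePre (a x) (G.functor.obj y)) : F ⟶ G :=
  Hom₂.mk ⟨a, fun x y => (VNatTrans.naturality_iff x y _ _).2 (h x y)⟩

/-- An invertible 2-cell with given components. -/
def mkIso {F G : X ⟶ Y} (a : ∀ x, 𝟙_ V ⟶ (F.functor.obj x ⟶[V] G.functor.obj x))
    (b : ∀ x, 𝟙_ V ⟶ (G.functor.obj x ⟶[V] F.functor.obj x))
    (hab : ∀ x, eUnitComp (a x) (b x) = eId V _) (hba : ∀ x, eUnitComp (b x) (a x) = eId V _)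
    (h : ∀ x y, F.functor.map x y ≫ ePost (F.functor.obj x) (a y) =
      G.functor.map x y ≫ ePre (a x) (G.functor.obj y)) : F ≅ G where
  hom := mkHom a h
  inv := mkHom b fun x y => by
    -- Naturality of the inverse is that of `a` with `b x` composed before and `b y` after; on each
    -- side one pair cancels.
    have h' := h x y =≫ (ePre (b x) _ ≫ ePost _ (b y))
    simp only [Category.assoc] at h'
    rw [← ePost_comp_ePre, ← reassoc_of% (ePost_eUnitComp _ (a y) (b y)), hab, ePost_id,
      Category.id_comp, ePost_comp_ePre, ← reassoc_of% (ePre_eUnitComp (b x) (a x) _), hba,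
      ePre_id, Category.id_comp] at h'
    exact h'.symm
  hom_inv_id := hom_ext₂ hab
  inv_hom_id := hom_ext₂ hba

end VCat

open VCat

variable {X Y Z W : VCat.{w} V}

/-- The inverse of the action of a fully faithful 1-cell on hom-objects. -/
noncomputable def fullyFaithful.invMap {m : Z ⟶ W} (hm : fullyFaithful m) (z z' : Z.carrier) :
    (m.functor.obj z ⟶[V] m.functor.obj z') ⟶ (z ⟶[V] z') :=
  @inv _ _ _ _ (m.functor.map z z') (hm z z')

lemma fullyFaithful.map_invMap {m : Z ⟶ W} (hm : fullyFaithful m) (z z' : Z.carrier) :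
    m.functor.map z z' ≫ hm.invMap z z' = 𝟙 _ :=
  @IsIso.hom_inv_id _ _ _ _ (m.functor.map z z') (hm z z')

lemma fullyFaithful.invMap_map {m : Z ⟶ W} (hm : fullyFaithful m) (z z' : Z.carrier) :
    hm.invMap z z' ≫ m.functor.map z z' = 𝟙 _ :=
  @IsIso.inv_hom_id _ _ _ _ (m.functor.map z z') (hm z z')

lemma fullyFaithful.cancel_map {m : Z ⟶ W} (hm : fullyFaithful m) {z z' : Z.carrier} {K : V}
    {f g : K ⟶ (z ⟶[V] z')} (h : f ≫ m.functor.map z z' = g ≫ m.functor.map z z') : f = g :=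
  have := hm z z'
  (cancel_mono (m.functor.map z z')).1 h

/-! ### Lifting along a fully faithful 1-cell -/

section Lift

variable {m : Z ⟶ W} (hm : fullyFaithful m) {G : Y ⟶ W} (o : Y.carrier → Z.carrier)
  (κ : ∀ y, 𝟙_ V ⟶ (m.functor.obj (o y) ⟶[V] G.functor.obj y))
  (κ' : ∀ y, 𝟙_ V ⟶ (G.functor.obj y ⟶[V] m.functor.obj (o y)))
  (h : ∀ y, eUnitComp (κ y) (κ' y) = eId V _) (h' : ∀ y, eUnitComp (κ' y) (κ y) = eId V _)

/-- The lift of `G` along a fully faithful 1-cell `m`, given objects `o y` and isomorphisms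
`m (o y) ≅ G y`. -/
noncomputable def fullyFaithfulLift : Y ⟶ Z where
  functor :=
    { obj := o
      map := fun y y' => G.functor.map y y' ≫ ePre (κ y) _ ≫ ePost _ (κ' y') ≫
        hm.invMap (o y) (o y')
      -- After applying `m`, the identity of `G y` conjugated by `κ y` and `κ' y` must be the
      -- identity, which is `h y`.
      map_id := fun y => hm.cancel_map (by
        simp only [Category.assoc, hm.invMap_map, Category.comp_id]
        rw [reassoc_of% G.functor.map_id, ← reassoc_of% eUnitComp_eq_ePre, eUnitComp_id,
          ← eUnitComp_eq_ePost, h, m.functor.map_id])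
      map_comp := fun y₁ y₂ y₃ => hm.cancel_map (by
        simp only [Category.assoc, hm.invMap_map, Category.comp_id, m.functor.map_comp,
          tensorHom_comp_tensorHom_assoc]
        -- At the middle object, the identity of `G y₂` is replaced by `κ' y₂` followed by `κ y₂`.
        rw [reassoc_of% G.functor.map_comp, eComp_ePre_ePost _ _ _ _ (h' y₂),
          tensorHom_comp_tensorHom_assoc]) }

/-- The image of the lift under `m` is isomorphic to `G`. -/
noncomputable def fullyFaithfulLiftIso : fullyFaithfulLift hm o κ κ' h h' ≫ m ≅ G :=
  mkIso κ κ' h h' fun y y' => by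
    change ((G.functor.map y y' ≫ ePre (κ y) _ ≫ ePost _ (κ' y') ≫ hm.invMap (o y) (o y')) ≫
      m.functor.map (o y) (o y')) ≫ ePost _ (κ y') = _
    simp only [Category.assoc, reassoc_of% hm.invMap_map]
    rw [← ePost_eUnitComp, h', ePost_id, Category.comp_id]
    rfl

end Lift

/-- The component of a 2-cell between composites with `m`. -/
def compApp {F G : X ⟶ Z} {m : Z ⟶ W} (b : F ≫ m ⟶ G ≫ m) (x : X.carrier) :
    𝟙_ V ⟶ (m.functor.obj (F.functor.obj x) ⟶[V] m.functor.obj (G.functor.obj x)) :=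
  app b x

lemma compApp_naturality {F G : X ⟶ Z} {m : Z ⟶ W} (b : F ≫ m ⟶ G ≫ m) (x y : X.carrier) :
    F.functor.map x y ≫ m.functor.map _ _ ≫ ePost _ (compApp b y) =
      G.functor.map x y ≫ m.functor.map _ _ ≫ ePre (compApp b x) _ := by
  rw [← Category.assoc, ← Category.assoc]
  exact app_naturality b x y

/-- Postcomposition with a fully faithful 1-cell is full and faithful on 2-cells. -/
noncomputable def postcompFullyFaithful (X : VCat.{w} V) {m : Z ⟶ W} (hm : fullyFaithful m) :
    (Bicategory.postcomp X m).FullyFaithful where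
  preimage {F G} b := mkHom (fun x => compApp b x ≫ hm.invMap _ _) fun x y => hm.cancel_map (by
    rw [Category.assoc, Category.assoc, ePost_map, ePre_map, Category.assoc, Category.assoc,
      hm.invMap_map, hm.invMap_map, Category.comp_id, Category.comp_id]
    exact compApp_naturality b x y)
  map_preimage {F G} b := hom_ext₂ fun x => by
    change (compApp b x ≫ hm.invMap _ _) ≫ m.functor.map _ _ = compApp b x
    rw [Category.assoc, hm.invMap_map, Category.comp_id]
  preimage_map {F G} a := hom_ext₂ fun x => by
    change (app a x ≫ m.functor.map _ _) ≫ hm.invMap _ _ = _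
    rw [Category.assoc, hm.map_invMap, Category.comp_id]

/-- Rephrases isomorphisms of the underlying ordinary category as mutually inverse elements of
hom-objects, the form in which they enter the lift. -/
lemma essSurj.exists_iso {e : X ⟶ Y} (he : essSurj e) (y : Y.carrier) :
    ∃ (x : X.carrier) (i : 𝟙_ V ⟶ (e.functor.obj x ⟶[V] y))
      (i' : 𝟙_ V ⟶ (y ⟶[V] e.functor.obj x)),
      eUnitComp i i' = eId V _ ∧ eUnitComp i' i = eId V _ := by
  obtain ⟨x, ⟨i⟩⟩ := he.mem_essImage (ForgetEnrichment.of V y)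
  refine ⟨ForgetEnrichment.to V x, ForgetEnrichment.homTo V i.hom,
    ForgetEnrichment.homTo V i.inv, ?_, ?_⟩
  · have := congrArg (ForgetEnrichment.homTo V) i.hom_inv_id
    rw [ForgetEnrichment.homTo_comp, ForgetEnrichment.homTo_id, Category.assoc] at this
    exact this
  · have := congrArg (ForgetEnrichment.homTo V) i.inv_hom_id
    rw [ForgetEnrichment.homTo_comp, ForgetEnrichment.homTo_id, Category.assoc] at this
    exact this

/-- Full faithfulness of the comparison functor comes from `m` alone; `he` enters only in
constructing diagonals. -/
theorem isOrthogonal_of_essSurj_of_fullyFaithful {e : X ⟶ Y} {m : Z ⟶ W} (he : essSurj e)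
    (hm : fullyFaithful m) : IsOrthogonal e m := by
  have faithful : (orthComparison e m).Faithful :=
    ⟨fun {h h' θ θ'} H => (postcompFullyFaithful Y hm).map_injective
      (congrArg CategoricalPullback.Hom.snd H)⟩
  have full : (orthComparison e m).Full := ⟨fun {h h'} f => by
    refine ⟨(postcompFullyFaithful Y hm).preimage f.snd, ?_⟩
    have h₂ := (postcompFullyFaithful Y hm).map_preimage f.snd
    refine CategoricalPullback.hom_ext ?_ h₂
    -- The second component determines the first: the compatibility squares determine its whiskering
    -- with `m`, the structure 2-cell being invertible, and that whiskering is faithful.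
    refine (postcompFullyFaithful X hm).map_injective ?_
    have w₁ := f.w
    have w₂ := ((orthComparison e m).map ((postcompFullyFaithful Y hm).preimage f.snd)).w
    have : ((orthComparison e m).map ((postcompFullyFaithful Y hm).preimage f.snd)).snd =
      f.snd := h₂
    rw [this, ← w₁, cancel_mono] at w₂
    exact w₂⟩
  have surj : (orthComparison e m).EssSurj := ⟨by
    rintro ⟨F, G, (iso : F ≫ m ≅ e ≫ G)⟩
    choose s i i' hi hi' using he.exists_iso
    let κ (y : Y.carrier) : 𝟙_ V ⟶ (m.functor.obj (F.functor.obj (s y)) ⟶[V] G.functor.obj y) :=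
      eUnitComp (y := G.functor.obj (e.functor.obj (s y))) (app iso.hom (s y))
        (i y ≫ G.functor.map _ _)
    let κ' (y : Y.carrier) : 𝟙_ V ⟶ (G.functor.obj y ⟶[V] m.functor.obj (F.functor.obj (s y))) :=
      eUnitComp (y := G.functor.obj (e.functor.obj (s y))) (i' y ≫ G.functor.map _ _)
        (app iso.inv (s y))
    have aux {a b c : W.carrier} (p : 𝟙_ V ⟶ (a ⟶[V] b)) (p' : 𝟙_ V ⟶ (b ⟶[V] a))
        (q : 𝟙_ V ⟶ (b ⟶[V] c)) (q' : 𝟙_ V ⟶ (c ⟶[V] b)) (hp : eUnitComp p p' = eId V a)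
        (hq : eUnitComp q q' = eId V b) :
        eUnitComp (eUnitComp p q) (eUnitComp q' p') = eId V a := by
      rw [eUnitComp_assoc, ← eUnitComp_assoc q, hq, id_eUnitComp, hp]
    have hκ (y : Y.carrier) : eUnitComp (κ y) (κ' y) = eId V _ :=
      aux _ _ _ _ (app_hom_inv iso (s y)) (by
        rw [← eUnitComp_map, hi]; exact G.functor.map_id _)
    have hκ' (y : Y.carrier) : eUnitComp (κ' y) (κ y) = eId V _ :=
      aux _ _ _ _ (by rw [← eUnitComp_map, hi', G.functor.map_id]) (app_inv_hom iso (s y))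
    let h := fullyFaithfulLift hm (G := G) (fun y => F.functor.obj (s y)) κ κ' hκ hκ'
    let j : h ≫ m ≅ G := fullyFaithfulLiftIso hm _ κ κ' hκ hκ'
    -- The compatibility square forces the value of `p` whiskered with `m`; this value is `k`, and
    -- `p` is obtained by reflecting it through `m`.
    let k : (e ≫ h) ≫ m ≅ F ≫ m :=
      Bicategory.associator e h m ≪≫ Bicategory.whiskerLeftIso e j ≪≫ iso.symm
    let p : e ≫ h ≅ F := (postcompFullyFaithful X hm).preimageIso k
    have hp : Bicategory.whiskerRight p.hom m = k.hom :=
      (postcompFullyFaithful X hm).map_preimage k.hom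
    have w : Bicategory.whiskerRight p.hom m ≫ iso.hom =
        (Bicategory.associator e h m).hom ≫ Bicategory.whiskerLeft e j.hom := by
      rw [hp]; simp [k]
    exact ⟨h, ⟨CategoricalPullback.mkIso p j w⟩⟩⟩
  exact { }

/-! ### Factorization through the full image -/

section Image

/-- The full image of `f`: the objects of the domain with the hom-objects of the codomain. -/
def fullImage (f : X ⟶ Y) : VCat.{w} V where
  carrier := X.carrier
  str :=
    { Hom := fun x x' => f.functor.obj x ⟶[V] f.functor.obj x'
      id := fun x => eId V (f.functor.obj x)
      comp := fun x y z => eComp V (f.functor.obj x) (f.functor.obj y) (f.functor.obj z)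
      id_comp := fun _ _ => e_id_comp V _ _
      comp_id := fun _ _ => e_comp_id V _ _
      assoc := fun _ _ _ _ => e_assoc V _ _ _ _ }

/-- The 1-cell to the full image. -/
def toFullImage (f : X ⟶ Y) : X ⟶ fullImage f where
  functor :=
    { obj := fun x => x
      map := f.functor.map
      map_id := f.functor.map_id
      map_comp := f.functor.map_comp }

/-- The inclusion of the full image. -/
def fullImageInclusion (f : X ⟶ Y) : fullImage f ⟶ Y where
  functor :=
    { obj := f.functor.obj
      map := fun _ _ => 𝟙 _
      map_id := fun _ => Category.comp_id _
      map_comp := fun x y z => by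
        refine (Category.comp_id _).trans ?_
        exact (congrArg (· ≫ eComp V (f.functor.obj x) (f.functor.obj y) (f.functor.obj z))
          (id_tensorHom_id _ _)).trans (Category.id_comp _) |>.symm }

/-- The second factor acts by identities on hom-objects, so the factorization is strict. -/
lemma toFullImage_comp (f : X ⟶ Y) : toFullImage f ≫ fullImageInclusion f = f :=
  VCat.Hom.ext (EnrichedFunctor.ext V (fun _ => rfl) fun _ _ =>
    (Category.comp_id _).trans (Category.comp_id _))

lemma fullyFaithful_fullImageInclusion (f : X ⟶ Y) : fullyFaithful (fullImageInclusion f) :=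
  fun _ _ => inferInstanceAs (IsIso (𝟙 _))

lemma essSurj_of_surjective {f : X ⟶ Y} (hf : Function.Surjective f.functor.obj) : essSurj f :=
  ⟨fun y => (hf (ForgetEnrichment.to V y)).elim fun x hx =>
    ⟨ForgetEnrichment.of V x, ⟨eqToIso (congrArg (ForgetEnrichment.of V) hx)⟩⟩⟩

end Image

theorem isOrthogonalFactorizationSystem_essSurj_fullyFaithful :
    IsOrthogonalFactorizationSystem (essSurj : MorphismProperty (VCat.{w} V)) fullyFaithful where
  factorization f := ⟨fullImage f, toFullImage f, fullImageInclusion f,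
    essSurj_of_surjective fun x => ⟨x, rfl⟩, fullyFaithful_fullImageInclusion f,
    ⟨eqToIso (toFullImage_comp f).symm⟩⟩
  orthogonal _ _ := isOrthogonal_of_essSurj_of_fullyFaithful

end Orthogonality


/-! ### Collages detect full faithfulness -/

section Generation

variable {V : Type u} [Category.{v} V] [MonoidalCategory V]

lemma eId_tensor {C : Type*} [EnrichedCategory V C] {x y : C} {K : V} (f : K ⟶ (x ⟶[V] y)) :
    (eId V x ⊗ₘ f) ≫ eComp V x x y = (λ_ K).hom ≫ f := by
  have h := e_id_comp V x y
  rw [Iso.inv_comp_eq, Category.comp_id] at h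
  rw [MonoidalCategory.tensorHom_def', Category.assoc, h, leftUnitor_naturality]

lemma tensor_eId {C : Type*} [EnrichedCategory V C] {x y : C} {K : V} (f : K ⟶ (x ⟶[V] y)) :
    (f ⊗ₘ eId V y) ≫ eComp V x y y = (ρ_ K).hom ≫ f := by
  have h := e_comp_id V x y
  rw [Iso.inv_comp_eq, Category.comp_id] at h
  rw [MonoidalCategory.tensorHom_def, Category.assoc, h, rightUnitor_naturality]

variable (V) in
/-- The unit `V`-category: one object, whose endomorphism object is the unit of `V`. -/
def unitVCat : VCat.{w} V where
  carrier := PUnit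
  str :=
    { Hom := fun _ _ => 𝟙_ V
      id := fun _ => 𝟙 _
      comp := fun _ _ _ => (λ_ _).hom
      id_comp := fun _ _ => by simp
      comp_id := fun _ _ => by simp [unitors_equal]
      assoc := fun _ _ _ _ => by simp [unitors_equal] }

/-- The 1-cell from the unit `V`-category picking an object. -/
def pickObj {Z : VCat.{w} V} (z : Z.carrier) : unitVCat.{w} V ⟶ Z where
  functor :=
    { obj := fun _ => z
      map := fun _ _ => eId V z
      map_id := fun _ => Category.id_comp _
      map_comp := fun _ _ _ => (eId_tensor (eId V z)).symm }

/-- An action of the unit `V`-category is already determined by its unit law. This avoids unfolding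
the transposed actions of the constant profunctor, braiding included. -/
lemma eq_leftUnitor_hom {K : V} {l : 𝟙_ V ⊗ K ⟶ K} (h : (λ_ K).inv ≫ 𝟙 (𝟙_ V) ▷ K ≫ l = 𝟙 K) :
    l = (λ_ K).hom := by
  rwa [id_whiskerRight, Category.id_comp, Iso.inv_comp_eq, Category.comp_id] at h

lemma eq_rightUnitor_hom {K : V} {r : K ⊗ 𝟙_ V ⟶ K} (h : (ρ_ K).inv ≫ K ◁ 𝟙 (𝟙_ V) ≫ r = 𝟙 K) :
    r = (ρ_ K).hom := by
  rwa [MonoidalCategory.whiskerLeft_id, Category.id_comp, Iso.inv_comp_eq, Category.comp_id] at h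

variable [SymmetricCategory V] [MonoidalClosed V]

open scoped MonoidalClosed

/-- The profunctor between unit `V`-categories with value `K`. -/
def constProfunctor (K : V) : VProfunctor (unitVCat.{w} V) (unitVCat.{w} V) where
  obj _ := K
  map _ _ := (λ_ (𝟙_ V)).hom ≫ eId V K
  map_id _ := by
    change ((λ_ (𝟙_ V)).inv ≫ (𝟙 (𝟙_ V) ⊗ₘ 𝟙 (𝟙_ V))) ≫ (λ_ (𝟙_ V)).hom ≫ eId V K = eId V K
    rw [id_tensorHom_id, Category.comp_id, Iso.inv_hom_id_assoc]
  map_comp _ _ _ := by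
    change (tensorμ (𝟙_ V) (𝟙_ V) (𝟙_ V) (𝟙_ V) ≫
      (((β_ (𝟙_ V) (𝟙_ V)).hom ≫ (λ_ (𝟙_ V)).hom) ⊗ₘ (λ_ (𝟙_ V)).hom)) ≫
        (λ_ (𝟙_ V)).hom ≫ eId V K =
      (((λ_ (𝟙_ V)).hom ≫ eId V K) ⊗ₘ ((λ_ (𝟙_ V)).hom ≫ eId V K)) ≫ eComp V K K K
    rw [← tensorHom_comp_tensorHom, Category.assoc, Category.assoc, eId_tensor (eId V K)]
    simp only [← Category.assoc]
    congr 1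
    -- All tensor factors are units, so the braidings reduce to unitors and what is left is monoidal
    -- coherence.
    simp only [tensorμ, braiding_tensorUnit_left]
    monoidal

lemma lact_constProfunctor (K : V) (b' b a) :
    (constProfunctor.{w} K).toBimodule.lact b' b a = (λ_ K).hom :=
  eq_leftUnitor_hom ((constProfunctor.{w} K).toBimodule.id_lact b a)

lemma ract_constProfunctor (K : V) (b a a') :
    (constProfunctor.{w} K).toBimodule.ract b a a' = (ρ_ K).hom :=
  eq_rightUnitor_hom ((constProfunctor.{w} K).toBimodule.ract_id b a)

variable [HasInitial V]

/-! ### 1-cells out of a collage -/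

namespace Bimodule

variable {A B E : VCat.{w} V} (M : Bimodule A B) (F : A ⟶ E) (G : B ⟶ E)
  (t : ∀ b a, M.obj b a ⟶ (G.functor.obj b ⟶[V] F.functor.obj a))

/-- The maps on hom-objects of the `V`-functor out of a collage. -/
noncomputable def collageDescMap : ∀ x y : A.carrier ⊕ B.carrier, M.collageHom x y ⟶
    (Sum.elim F.functor.obj G.functor.obj x ⟶[V] Sum.elim F.functor.obj G.functor.obj y)
  | .inl a, .inl a' => F.functor.map a a'
  | .inr b, .inr b' => G.functor.map b b'
  | .inl _, .inr _ => initial.to _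
  | .inr b, .inl a => t b a

/-- The 1-cell out of a collage given by 1-cells `F` and `G` and an equivariant family of maps
`M(b, a) ⟶ E(G b, F a)`. -/
noncomputable def collageDesc
    (hl : ∀ b' b a, M.lact b' b a ≫ t b' a = (G.functor.map b' b ⊗ₘ t b a) ≫ eComp V _ _ _)
    (hr : ∀ b a a', M.ract b a a' ≫ t b a' = (t b a ⊗ₘ F.functor.map a a') ≫ eComp V _ _ _) :
    M.collage ⟶ E where
  functor :=
    { obj := Sum.elim F.functor.obj G.functor.obj
      map := M.collageDescMap F G t
      map_id := by
        rintro (a | b)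
        · exact F.functor.map_id a
        · exact G.functor.map_id b
      map_comp := by
        rintro (x | x) (y | y) (z | z)
        · exact F.functor.map_comp x y z
        · exact tensor_initial_hom_ext _ _
        · exact initial_tensor_hom_ext _ _
        · exact initial_tensor_hom_ext _ _
        · exact hr x y z
        · exact tensor_initial_hom_ext _ _
        · exact hl x y z
        · exact G.functor.map_comp x y z }

end Bimodule

lemma essSurj_collageInclusion {A B : VCat.{w} V} (P : VProfunctor A B) :
    essSurj (VProfunctor.collageInclusion P) :=
  essSurj_of_surjective (by
    rintro (a | b)
    · exact ⟨Sum.inl a, rfl⟩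
    · exact ⟨Sum.inr b, rfl⟩)

/-! ### Testing a 1-cell on collages of constant profunctors -/

section

variable {Z W : VCat.{w} V} {K : V} {x y : Z.carrier}

/-- The 1-cell out of the collage of a constant profunctor given by `K ⟶ Z(x, y)`. -/
noncomputable def constCollageDesc (f : K ⟶ (x ⟶[V] y)) :
    (constProfunctor.{w} K).collage ⟶ Z :=
  (constProfunctor.{w} K).toBimodule.collageDesc (pickObj y) (pickObj x) (fun _ _ => f)
    (fun b' b a => (congrArg (· ≫ f) (lact_constProfunctor K b' b a)).trans (eId_tensor f).symm)
    (fun b a a' => (congrArg (· ≫ f) (ract_constProfunctor K b a a')).trans (tensor_eId f).symm)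

/-- Together with the next two lemmas, this describes composition with `m` and restriction to the
coproduct as strict equalities, so the squares to be filled have structure 2-cells with identity
components. -/
lemma constCollageDesc_comp (f : K ⟶ (x ⟶[V] y)) (m : Z ⟶ W) :
    constCollageDesc f ≫ m = constCollageDesc (f ≫ m.functor.map x y) :=
  VCat.Hom.ext (EnrichedFunctor.ext V (by rintro (a | b) <;> rfl) (by
    rintro (a | b) (a' | b')
    · exact (Category.comp_id _).trans (m.functor.map_id y)
    · exact initialIsInitial.hom_ext _ _
    · exact Category.comp_id _
    · exact (Category.comp_id _).trans (m.functor.map_id x)))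

lemma collageInclusion_constCollageDesc (f : K ⟶ (x ⟶[V] y)) :
    VProfunctor.collageInclusion (constProfunctor.{w} K) ≫ constCollageDesc f =
      coprodDesc (pickObj y) (pickObj x) :=
  VCat.Hom.ext (EnrichedFunctor.ext V (by rintro (a | b) <;> rfl) (by
    rintro (a | b) (a' | b')
    · exact (Category.comp_id _).trans (Category.id_comp _)
    · exact initialIsInitial.hom_ext _ _
    · exact initialIsInitial.hom_ext _ _
    · exact (Category.comp_id _).trans (Category.id_comp _)))

lemma coprodDesc_pickObj_comp (x y : Z.carrier) (m : Z ⟶ W) :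
    coprodDesc (pickObj.{w} y) (pickObj x) ≫ m =
      coprodDesc (pickObj (m.functor.obj y)) (pickObj (m.functor.obj x)) :=
  VCat.Hom.ext (EnrichedFunctor.ext V (by rintro (a | b) <;> rfl) (by
    rintro (a | b) (a' | b')
    · exact (Category.comp_id _).trans (m.functor.map_id y)
    · exact initialIsInitial.hom_ext _ _
    · exact initialIsInitial.hom_ext _ _
    · exact (Category.comp_id _).trans (m.functor.map_id x)))

open VCat

/-- The two `V`-functors classified by `f` and `g` agree both on the coproduct and after `m`.
Fullness of the comparison functor lifts these equalities to a 2-cell with identity components, and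
its naturality at the hom-object `K` reads `f = g`. -/
lemma eq_of_comp_map_eq {m : Z ⟶ W}
    (hm : IsOrthogonal (VProfunctor.collageInclusion (constProfunctor.{w} K)) m)
    {f g : K ⟶ (x ⟶[V] y)} (h : f ≫ m.functor.map x y = g ≫ m.functor.map x y) : f = g := by
  let e := VProfunctor.collageInclusion (constProfunctor.{w} K)
  have h₁ : e ≫ constCollageDesc f = e ≫ constCollageDesc g := by
    rw [collageInclusion_constCollageDesc, collageInclusion_constCollageDesc]
  have h₂ : constCollageDesc f ≫ m = constCollageDesc g ≫ m := by
    rw [constCollageDesc_comp, constCollageDesc_comp, h]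
  have hw : Bicategory.whiskerRight (eqToHom h₁) m ≫
      (Bicategory.associator e (constCollageDesc g) m).hom =
      (Bicategory.associator e (constCollageDesc f) m).hom ≫
        Bicategory.whiskerLeft e (eqToHom h₂) := by
    refine hom_ext₂ ?_
    -- The associators have identity components, so it remains to compare the two whiskered
    -- equalities, whose components are identities too.
    rintro (a | b) <;> refine (eUnitComp_id _).trans (Eq.trans ?_ (id_eUnitComp _).symm)
    · exact (congrArg (· ≫ m.functor.map y y)
        ((app_eqToHom h₁ (Sum.inl a)).trans (Category.comp_id _))).trans
        ((m.functor.map_id y).trans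
          ((app_eqToHom h₂ (Sum.inl a)).trans (Category.comp_id _)).symm)
    · exact (congrArg (· ≫ m.functor.map x x)
        ((app_eqToHom h₁ (Sum.inr b)).trans (Category.comp_id _))).trans
        ((m.functor.map_id x).trans
          ((app_eqToHom h₂ (Sum.inr b)).trans (Category.comp_id _)).symm)
  have : (orthComparison e m).IsEquivalence := hm
  obtain ⟨θ, hθ⟩ := (orthComparison e m).map_surjective
    (X := constCollageDesc f) (Y := constCollageDesc g) ⟨eqToHom h₁, eqToHom h₂, hw⟩
  have hθ' : Bicategory.whiskerLeft e θ = eqToHom h₁ :=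
    congrArg CategoricalPullback.Hom.fst hθ
  have hl : app θ (Sum.inl ⟨⟩) = eId V y :=
    (congrArg (app · (Sum.inl ⟨⟩)) hθ').trans
      ((app_eqToHom h₁ (Sum.inl ⟨⟩)).trans (Category.comp_id _))
  have hr : app θ (Sum.inr ⟨⟩) = eId V x :=
    (congrArg (app · (Sum.inr ⟨⟩)) hθ').trans
      ((app_eqToHom h₁ (Sum.inr ⟨⟩)).trans (Category.comp_id _))
  have nat : f ≫ ePost x (app θ (Sum.inl ⟨⟩)) = g ≫ ePre (app θ (Sum.inr ⟨⟩)) y :=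
    app_naturality θ (Sum.inr ⟨⟩) (Sum.inl ⟨⟩)
  have nat' : f ≫ ePost x (eId V y) = g ≫ ePre (eId V x) y :=
    (congrArg (fun k => f ≫ ePost x k) hl.symm).trans
      (nat.trans (congrArg (fun k => g ≫ ePre k y) hr))
  simpa using nat'

/-- The identity of `W(m x, m y)` classifies a `V`-functor from the collage to `W` whose restriction
lifts to `Z` through `y` and `x`. A diagonal for this square carries a map from `W(m x, m y)` to a
hom-object of `Z`, which only has to be transported to `Z(x, y)`. -/
lemma exists_section_map {m : Z ⟶ W} (x y : Z.carrier)
    (hm : IsOrthogonal (VProfunctor.collageInclusion (constProfunctor.{w}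
      (m.functor.obj x ⟶[V] m.functor.obj y))) m) :
    ∃ s : (m.functor.obj x ⟶[V] m.functor.obj y) ⟶ (x ⟶[V] y),
      s ≫ m.functor.map x y = 𝟙 _ := by
  let e := VProfunctor.collageInclusion (constProfunctor.{w}
      (m.functor.obj x ⟶[V] m.functor.obj y))
  let F := coprodDesc (pickObj.{w} y) (pickObj x)
  let G := constCollageDesc (𝟙 (m.functor.obj x ⟶[V] m.functor.obj y))
  have hFG : F ≫ m = e ≫ G :=
    (coprodDesc_pickObj_comp x y m).trans (collageInclusion_constCollageDesc _).symm
  have : (orthComparison e m).IsEquivalence := hm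
  -- The diagonal matches `F` and `G` only up to isomorphism: its two objects `b` and `a` are merely
  -- isomorphic to `x` and `y`, hence the conjugation below.
  let h := (orthComparison e m).objPreimage ⟨F, G, eqToIso hFG⟩
  let Φ := (orthComparison e m).objObjPreimageIso ⟨F, G, eqToIso hFG⟩
  let p : e ≫ h ≅ F := (CategoricalPullback.π₁ _ _).mapIso Φ
  let q : h ≫ m ⟶ G := Φ.hom.snd
  have hw : Bicategory.whiskerRight p.hom m ≫ eqToHom hFG =
    (Bicategory.associator e h m).hom ≫ Bicategory.whiskerLeft e q := Φ.hom.w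
  let a : Z.carrier := h.functor.obj (Sum.inl ⟨⟩)
  let b : Z.carrier := h.functor.obj (Sum.inr ⟨⟩)
  let pa : 𝟙_ V ⟶ (a ⟶[V] y) := app p.hom (Sum.inl ⟨⟩)
  let pb : 𝟙_ V ⟶ (b ⟶[V] x) := app p.hom (Sum.inr ⟨⟩)
  let pb' : 𝟙_ V ⟶ (x ⟶[V] b) := app p.inv (Sum.inr ⟨⟩)
  let qa : 𝟙_ V ⟶ (m.functor.obj a ⟶[V] m.functor.obj y) := app q (Sum.inl ⟨⟩)
  let qb : 𝟙_ V ⟶ (m.functor.obj b ⟶[V] m.functor.obj x) := app q (Sum.inr ⟨⟩)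
  let t : (m.functor.obj x ⟶[V] m.functor.obj y) ⟶ (b ⟶[V] a) :=
    h.functor.map (Sum.inr ⟨⟩) (Sum.inl ⟨⟩)
  have hpb : eUnitComp pb' pb = eId V x := app_inv_hom p (Sum.inr ⟨⟩)
  -- Since the structure 2-cell of the square has identity components, compatibility says that `q`
  -- is the image under `m` of `p` on objects.
  have hqa : pa ≫ m.functor.map a y = qa :=
    (((congrArg (eUnitComp (pa ≫ m.functor.map a y))
      ((app_eqToHom hFG (Sum.inl ⟨⟩)).trans (Category.comp_id _))).trans
        (eUnitComp_id _)).symm.trans (congrArg (app · (Sum.inl ⟨⟩)) hw)).trans (id_eUnitComp _)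
  have hqb : pb ≫ m.functor.map b x = qb :=
    (((congrArg (eUnitComp (pb ≫ m.functor.map b x))
      ((app_eqToHom hFG (Sum.inr ⟨⟩)).trans (Category.comp_id _))).trans
        (eUnitComp_id _)).symm.trans (congrArg (app · (Sum.inr ⟨⟩)) hw)).trans (id_eUnitComp _)
  have nat : (t ≫ m.functor.map b a) ≫ ePost (m.functor.obj b) qa =
      𝟙 _ ≫ ePre qb (m.functor.obj y) := app_naturality q (Sum.inr ⟨⟩) (Sum.inl ⟨⟩)
  rw [Category.id_comp, Category.assoc] at nat
  -- The section is the action `t` of the diagonal, transported along `x ≅ b` and `a ≅ y`. Under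
  -- `m`, naturality of `q` trades `qa` for `qb`, which cancels against the image of `pb'`.
  refine ⟨t ≫ ePre pb' a ≫ ePost x pa, ?_⟩
  rw [Category.assoc, Category.assoc, ePost_map, reassoc_of% ePre_map, hqa, ← ePost_comp_ePre,
    reassoc_of% nat, ← hqb, ← ePre_eUnitComp, ← eUnitComp_map, hpb, m.functor.map_id, ePre_id]

/-- Cancellation at `K = Z(x, y)` upgrades the section to a two-sided inverse. -/
theorem fullyFaithful_of_isOrthogonal {m : Z ⟶ W}
    (hm : ∀ K : V, IsOrthogonal (VProfunctor.collageInclusion (constProfunctor.{w} K)) m) :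
    fullyFaithful m := fun x y => by
  obtain ⟨s, hs⟩ := exists_section_map x y (hm _)
  exact ⟨s, eq_of_comp_map_eq (hm _) (by rw [Category.assoc, hs, Category.comp_id,
    Category.id_comp]), hs⟩

end

end Generation

end EnrichedOFS

theorem mainTheorem6 (V : Type u) [Category.{v} V] [MonoidalCategory V]
    [SymmetricCategory V] [MonoidalClosed V] [HasLimits V] [HasColimits V] :
    EnrichedOFS.IsGeneratedOrthogonalFactorizationSystem
        (EnrichedOFS.essSurj : MorphismProperty (EnrichedOFS.VCat.{w} V))
        EnrichedOFS.fullyFaithful EnrichedOFS.collageInclusions ∧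
      ∀ {C D : EnrichedOFS.VCat.{w} V} (F : C ⟶ D),
        (∀ {A B : EnrichedOFS.VCat.{w} V} (P : EnrichedOFS.VProfunctor A B),
          EnrichedOFS.IsOrthogonal (EnrichedOFS.VProfunctor.collageInclusion P) F) →
        EnrichedOFS.fullyFaithful F := by
  refine ⟨{
    toIsOrthogonalFactorizationSystem :=
      EnrichedOFS.isOrthogonalFactorizationSystem_essSurj_fullyFaithful
    -- Only the collages of constant profunctors are needed to recover full faithfulness; the
    -- forward direction treats an arbitrary collage.
    right_iff := fun m => ⟨fun hm X Y e he => ?_, fun hm =>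
      EnrichedOFS.fullyFaithful_of_isOrthogonal fun K =>
        hm _ (EnrichedOFS.collageInclusions.mk _)⟩ }, fun F hF =>
      EnrichedOFS.fullyFaithful_of_isOrthogonal fun K => hF _⟩
  obtain ⟨P⟩ := he
  exact EnrichedOFS.isOrthogonal_of_essSurj_of_fullyFaithful
    (EnrichedOFS.essSurj_collageInclusion P) hm
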